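/- Let $K$ be a quadratic field with field embeddings $\sigma_\infty:K\to\mathbb R$ and $\sigma_2:K\to\mathbb Q_2$; for $x\in K$ write $x_\infty=\sigma_\infty(x)$ and $x_{\langle 2\rangle}=\sigma_2(x)$. Let $v_2$ be the $2$-adic valuation and $|\cdot|_2=2^{-v_2(\cdot)}$. For $u=\sum_{k\ge v_2(u)}c_k2^k\in\mathbb Q_2$ with $c_k\in\{0,1\}$ put $\lfloor u\rfloor_2=\sum_{k\le 0}c_k2^k\in\mathbb Z[\tfrac12]$. For $n\in\mathbb Z$ let $\tau(n)=0$ if $n$ is even and $\tau(n)=1$ if $n$ is odd. For $x\in K^\times$ and $\varepsilon\in\{0,1\}$ let $s=2$ if $\varepsilon=0$ and $s=1$ if $\varepsilon=1$, let $m$ be the smallest of those $i\in\mathbb Z$ for which $\left|(1/x)_\infty-is-\lfloor(1/x)_{\langle2\rangle}\rfloor_2\right|$ is minimal, and put $a^{(\varepsilon)}(x)=ms+\lfloor(1/x)_{\langle2\rangle}\rfloor_2$ and $T_{\varepsilon}(x)=\frac1x-a^{(\varepsilon)}(x)$. Let $\alpha\in K\setminus\mathbb Q$ have property $I$, that is,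 $\alpha_\infty\in(-1,1]$ and $v_2(\alpha_{\langle2\rangle})>0$. Define $\alpha_{(1)}=\alpha$ and, for $n\ge1$, $a_n=a^{(\tau(n))}(\alpha_{(n)})$ and $\alpha_{(n+1)}=T_{\tau(n)}(\alpha_{(n)})$ (no $\alpha_{(n)}$ is $0$, as $\alpha$ is irrational). For $n\ge1$ define $p_n,q_n\in\mathbb Z[\tfrac12]$ by $$\begin{pmatrix}p_{n-1}&p_n\\ q_{n-1}&q_n\end{pmatrix}=\begin{pmatrix}0&1\\1&a_1\end{pmatrix}\cdots\begin{pmatrix}0&1\\1&a_n\end{pmatrix},\qquad p_0=0,\ q_0=1,$$ and put $p'_n=2^{-\sum_{s=1}^nv_2(a_s)}p_n$ and $q'_n=2^{-\sum_{s=1}^nv_2(a_s)}q_n$ (these are coprime integers and $q'_n\neq0$). Then there is a constant $C>0$ such that for all integers $n\ge1$ $$\frac{C}{|q'_n|^2}<\left|\alpha_\infty-\frac{p'_n}{q'_n}\right|\left|\alpha_{\langle2\rangle}-\frac{p'_n}{q'_n}\right|_2<\frac{2}{(1+\tau(n))\,|a_{n+1}|_2\,|q'_n|^2},$$ and moreover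 $$\left|\alpha_\infty-\frac{p'_n}{q'_n}\right|\left|\alpha_{\langle2\rangle}-\frac{p'_n}{q'_n}\right|_2<\frac1{|q'_n|^2}.$$ -/

import Mathlib

namespace PadicRealCF

noncomputable section

/-! ### The `p`-adic floor -/

/-- `p^(-v(u)) u` lies in `ℤ_p` (it is a unit if `u ≠ 0`, and it is `0` if `u = 0`). -/
theorem norm_unitPart_le_one (p : ℕ) [Fact p.Prime] (u : ℚ_[p]) :
    ‖u * (p : ℚ_[p]) ^ (-u.valuation)‖ ≤ 1 := by
  have hp : (0 : ℝ) < p := by exact_mod_cast (Fact.out : p.Prime).pos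
  rcases eq_or_ne u 0 with rfl | hu
  · simp
  · rw [norm_mul, Padic.norm_eq_zpow_neg_valuation hu, Padic.norm_p_zpow, ← zpow_add₀ hp.ne']
    simp

/-- `p^(-v(u)) u` as a `p`-adic integer. -/
def unitPart (p : ℕ) [Fact p.Prime] (u : ℚ_[p]) : ℤ_[p] :=
  ⟨u * (p : ℚ_[p]) ^ (-u.valuation), norm_unitPart_le_one p u⟩

/-- The digit `c_n ∈ {0, …, p-1}` in the expansion `u = ∑ c_n p^n`, with `c_n = 0` for `n < v(u)`.
For `j ≥ 0`, `c_{v(u)+j}` is the `j`-th digit of `w = p^(-v(u)) u ∈ ℤ_p`; the natural number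
`w.appr (j+1) < p^(j+1)` is the residue of `w` modulo `p^(j+1)`, so this is its leading digit. -/
def padicDigit (p : ℕ) [Fact p.Prime] (u : ℚ_[p]) (n : ℤ) : ℕ :=
  if n < u.valuation then 0
  else (unitPart p u).appr ((n - u.valuation).toNat + 1) / p ^ (n - u.valuation).toNat

/-- `⌊u⌋_p = ∑_{n ≤ 0} c_n p^n`, a rational number (the digits below `v(u)` vanish). -/
def padicFloor (p : ℕ) [Fact p.Prime] (u : ℚ_[p]) : ℚ :=
  ∑ n ∈ Finset.Icc u.valuation 0, (padicDigit p u n : ℚ) * (p : ℚ) ^ n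

/-! ### The maps `T_{p,0}` and `T_{p,1}` -/

/-- `τ(n) = 0` for even `n` and `τ(n) = 1` for odd `n`. -/
def tau (n : ℤ) : ℕ := if Even n then 0 else 1

/-- The spacing of the integers to choose from: `p` for `ε = 0`, and `1` for `ε = 1`. -/
def step (p ε : ℕ) : ℕ := if ε = 0 then p else 1

/-- The smallest among those `i ∈ ℤ` for which `|x - i s|` attains its minimum. -/
def nearestIndex (x : ℝ) (s : ℕ) : ℤ :=
  sInf {i : ℤ | ∀ j : ℤ, |x - i * s| ≤ |x - j * s|}

variable {K : Type*} [Field K]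

/-- The partial quotient `a^{(ε)}(α) = m s + ⌊(1/α)_{⟨p⟩}⌋_p`, where `s = p` for `ε = 0` and
`s = 1` for `ε = 1`, and `m` is the smallest of the `i ∈ ℤ` for which
`|(1/α)_∞ - i s - ⌊(1/α)_{⟨p⟩}⌋_p|` is minimal. Used for `α ≠ 0` only. -/
def partialQuot (p : ℕ) [Fact p.Prime] (σinf : K →+* ℝ) (σp : K →+* ℚ_[p]) (ε : ℕ) (α : K) : ℚ :=
  (nearestIndex (σinf (1 / α) - (padicFloor p (σp (1 / α)) : ℝ)) (step p ε) : ℚ) * (step p ε : ℚ)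
    + padicFloor p (σp (1 / α))

/-- `T_{p,ε}(α) = 1/α - a^{(ε)}(α)`. Used for `α ≠ 0` only. -/
def T (p : ℕ) [Fact p.Prime] (σinf : K →+* ℝ) (σp : K →+* ℚ_[p]) (ε : ℕ) (α : K) : K :=
  1 / α - (partialQuot p σinf σp ε α : K)

/-- Property `I`: `α_∞ ∈ (-p/2, p/2]` and `v_p(α_{⟨p⟩}) > 0` (here `v_p(0) = ⊤`). -/
def PropertyI (p : ℕ) [Fact p.Prime] (σinf : K →+* ℝ) (σp : K →+* ℚ_[p]) (α : K) : Prop :=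
  σinf α ∈ Set.Ioc (-(p : ℝ) / 2) ((p : ℝ) / 2) ∧ 0 < Padic.addValuation (σp α)

/-! ### The algorithm and its convergents -/

/-- `alphaSeq n` is `α_{(n)}` for `n ≥ 1`: `α_{(1)} = α`, and `α_{(n+1)} = T_{p,τ(n)}(α_{(n)})`.
The value at `0` is a dummy. The algorithm stops at a zero term, which does not occur for
irrational `α` (see `alphaSeq_ne_zero`). -/
def alphaSeq (p : ℕ) [Fact p.Prime] (σinf : K →+* ℝ) (σp : K →+* ℚ_[p]) (α : K) : ℕ → K
  | 0 => α
  | 1 => α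
  | n + 2 => T p σinf σp (tau (n + 1)) (alphaSeq p σinf σp α (n + 1))

/-- The partial quotients `a_n(α) = a^{(τ(n))}(α_{(n)})`, for `n ≥ 1`. -/
def aSeq (p : ℕ) [Fact p.Prime] (σinf : K →+* ℝ) (σp : K →+* ℚ_[p]) (α : K) (n : ℕ) : ℚ :=
  partialQuot p σinf σp (tau n) (alphaSeq p σinf σp α n)

/-- The matrix `(p_{n-1}, p_n; q_{n-1}, q_n)`, that is, the product of the matrices
`(0, 1; 1, a_k(α))` for `k = 1, …, n`. -/
def convMatrix (p : ℕ) [Fact p.Prime] (σinf : K →+* ℝ) (σp : K →+* ℚ_[p]) (α : K) :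
    ℕ → Matrix (Fin 2) (Fin 2) ℚ
  | 0 => 1
  | n + 1 => convMatrix p σinf σp α n * !![0, 1; 1, aSeq p σinf σp α (n + 1)]

/-- The numerator `p_n`. -/
def convNum (p : ℕ) [Fact p.Prime] (σinf : K →+* ℝ) (σp : K →+* ℚ_[p]) (α : K) (n : ℕ) : ℚ :=
  convMatrix p σinf σp α n 0 1

/-- The denominator `q_n`. -/
def convDen (p : ℕ) [Fact p.Prime] (σinf : K →+* ℝ) (σp : K →+* ℚ_[p]) (α : K) (n : ℕ) : ℚ :=
  convMatrix p σinf σp α n 1 1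

/-- The factor `p ^ (- ∑_{s=1}^n v_p(a_s(α)))`. -/
def convScale (p : ℕ) [Fact p.Prime] (σinf : K →+* ℝ) (σp : K →+* ℚ_[p]) (α : K) (n : ℕ) : ℚ :=
  (p : ℚ) ^ (-∑ s ∈ Finset.Icc 1 n, padicValRat p (aSeq p σinf σp α s))

/-- `p'_n = p ^ (- ∑_{s=1}^n v_p(a_s(α))) p_n` (an integer, see `exists_int_convergent`). -/
def convNum' (p : ℕ) [Fact p.Prime] (σinf : K →+* ℝ) (σp : K →+* ℚ_[p]) (α : K) (n : ℕ) : ℚ :=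
  convScale p σinf σp α n * convNum p σinf σp α n

/-- `q'_n = p ^ (- ∑_{s=1}^n v_p(a_s(α))) q_n` (an integer, see `exists_int_convergent`). -/
def convDen' (p : ℕ) [Fact p.Prime] (σinf : K →+* ℝ) (σp : K →+* ℚ_[p]) (α : K) (n : ℕ) : ℚ :=
  convScale p σinf σp α n * convDen p σinf σp α n

/-! ### The definitions are meaningful -/

theorem sum_padicDigit (p : ℕ) [Fact p.Prime] (u : ℚ_[p]) (j : ℕ) :
    ∑ n ∈ Finset.Icc u.valuation (u.valuation + j), (padicDigit p u n : ℚ) * (p : ℚ) ^ n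
      = (unitPart p u).appr (j + 1) * (p : ℚ) ^ u.valuation := by
  have hp : (p : ℚ) ≠ 0 := by exact_mod_cast (Fact.out : p.Prime).ne_zero
  have key : ∀ j : ℕ, (unitPart p u).appr (j + 1)
      = (unitPart p u).appr j + p ^ j * ((unitPart p u).appr (j + 1) / p ^ j) := by
    intro j
    obtain ⟨c, hc⟩ := (unitPart p u).dvd_appr_sub_appr j (j + 1) (Nat.le_succ j)
    have hm := (unitPart p u).appr_mono (Nat.le_succ j)
    have hlt := (unitPart p u).appr_lt j
    have h1 : (unitPart p u).appr (j + 1) = (unitPart p u).appr j + p ^ j * c := by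
      simp only [Nat.succ_eq_add_one] at hm
      omega
    have h2 : (unitPart p u).appr (j + 1) / p ^ j = c := by
      rw [h1, Nat.add_mul_div_left _ _ (pow_pos (Fact.out : p.Prime).pos j), Nat.div_eq_of_lt hlt,
        zero_add]
    rw [h2]; exact h1
  have hdig : ∀ j : ℕ, padicDigit p u (u.valuation + j)
      = (unitPart p u).appr (j + 1) / p ^ j := by
    intro j
    simp [padicDigit]
  induction j with
  | zero =>
    have h0 := hdig 0
    simp only [Nat.cast_zero, add_zero, zero_add, pow_zero, Nat.div_one] at h0
    simp [h0]
  | succ j ih =>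
    have hI : Finset.Icc u.valuation (u.valuation + ((j + 1 : ℕ) : ℤ))
        = insert (u.valuation + ((j + 1 : ℕ) : ℤ))
          (Finset.Icc u.valuation (u.valuation + (j : ℤ))) := by
      ext x
      simp only [Finset.mem_Icc, Finset.mem_insert]
      push_cast
      omega
    have hk : ((unitPart p u).appr (j + 1 + 1) : ℚ) = (unitPart p u).appr (j + 1)
        + (p : ℚ) ^ (j + 1) * ((unitPart p u).appr (j + 1 + 1) / p ^ (j + 1) : ℕ) := by
      exact_mod_cast key (j + 1)
    rw [hI, Finset.sum_insert (by simp), ih, hdig, zpow_add₀ hp, zpow_natCast, hk]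
    ring

/-- The digit expansion converges to `u`: its truncation at `p^N` is within `p^(-N-1)` of `u`. -/
theorem norm_sub_sum_padicDigit_lt (p : ℕ) [Fact p.Prime] (u : ℚ_[p]) (N : ℤ) :
    ‖u - ((∑ n ∈ Finset.Icc u.valuation N, (padicDigit p u n : ℚ) * (p : ℚ) ^ n : ℚ) : ℚ_[p])‖
      < (p : ℝ) ^ (-N) := by
  have hp1 : (1 : ℝ) < p := by exact_mod_cast (Fact.out : p.Prime).one_lt
  have hp0 : (0 : ℝ) < p := by linarith
  have hpp : (p : ℚ_[p]) ≠ 0 := by exact_mod_cast (Fact.out : p.Prime).ne_zero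
  rcases lt_or_ge N u.valuation with h | h
  · rw [Finset.Icc_eq_empty (by omega)]
    rcases eq_or_ne u 0 with rfl | hu
    · simpa using zpow_pos hp0 _
    · simp only [Finset.sum_empty, Rat.cast_zero, sub_zero]
      rw [Padic.norm_eq_zpow_neg_valuation hu]
      exact zpow_lt_zpow_right₀ hp1 (by omega)
  · obtain ⟨j, rfl⟩ : ∃ j : ℕ, N = u.valuation + j := ⟨(N - u.valuation).toNat, by omega⟩
    rw [sum_padicDigit]
    have hs := (unitPart p u).appr_spec (j + 1)
    rw [← PadicInt.norm_le_pow_iff_mem_span_pow] at hs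
    have hu : u = ((unitPart p u : ℤ_[p]) : ℚ_[p]) * (p : ℚ_[p]) ^ u.valuation := by
      simp [unitPart, mul_assoc, inv_mul_cancel₀ (zpow_ne_zero _ hpp)]
    have he : u - (((unitPart p u).appr (j + 1) * (p : ℚ) ^ u.valuation : ℚ) : ℚ_[p])
        = ((unitPart p u - (unitPart p u).appr (j + 1) : ℤ_[p]) : ℚ_[p])
          * (p : ℚ_[p]) ^ u.valuation := by
      have h2 : ((unitPart p u - (unitPart p u).appr (j + 1) : ℤ_[p]) : ℚ_[p])
          * (p : ℚ_[p]) ^ u.valuation = ((unitPart p u : ℤ_[p]) : ℚ_[p]) * (p : ℚ_[p]) ^ u.valuation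
            - (unitPart p u).appr (j + 1) * (p : ℚ_[p]) ^ u.valuation := by
        push_cast; ring
      rw [h2, ← hu]
      push_cast
      rfl
    rw [he, norm_mul, Padic.norm_p_zpow, ← PadicInt.norm_def]
    calc _ ≤ (p : ℝ) ^ (-((j + 1 : ℕ) : ℤ)) * (p : ℝ) ^ (-u.valuation) := by gcongr
      _ = (p : ℝ) ^ (-((j + 1 : ℕ) : ℤ) + -u.valuation) := (zpow_add₀ hp0.ne' _ _).symm
      _ < _ := zpow_lt_zpow_right₀ hp1 (by push_cast; omega)

theorem norm_sub_padicFloor_lt (p : ℕ) [Fact p.Prime] (u : ℚ_[p]) :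
    ‖u - (padicFloor p u : ℚ_[p])‖ < 1 := by
  simpa [padicFloor] using norm_sub_sum_padicDigit_lt p u 0

/-- The minimum in the definition of `nearestIndex` is attained, and there is a smallest `i`. -/
theorem isLeast_nearestIndex (x : ℝ) (s : ℕ) (hs : 0 < s) :
    IsLeast {i : ℤ | ∀ j : ℤ, |x - i * s| ≤ |x - j * s|} (nearestIndex x s) := by
  have hs' : (0 : ℝ) < s := by exact_mod_cast hs
  have hne : {i : ℤ | ∀ j : ℤ, |x - i * s| ≤ |x - j * s|}.Nonempty := by
    refine ⟨round (x / s), fun j => ?_⟩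
    have h := round_le (x / s) j
    have e : ∀ i : ℤ, |x - i * s| = |x / s - i| * s := by
      intro i
      rw [← abs_of_pos hs', ← abs_mul, abs_of_pos hs', sub_mul, div_mul_cancel₀ _ hs'.ne']
    rw [e, e]
    gcongr
  have hb : BddBelow {i : ℤ | ∀ j : ℤ, |x - i * s| ≤ |x - j * s|} := by
    refine ⟨⌊(x - |x|) / s⌋, fun i hi => ?_⟩
    have h := hi 0
    simp only [Int.cast_zero, zero_mul, sub_zero] at h
    have h1 : x - i * s ≤ |x| := (le_abs_self _).trans h
    have h2 : (x - |x|) / s ≤ i := by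
      rw [div_le_iff₀ hs']; linarith
    exact Int.cast_le.mp ((Int.floor_le _).trans h2)
  exact ⟨Int.csInf_mem hne hb, fun i hi => csInf_le hb hi⟩

/-- For irrational `α` no term of the algorithm is rational; so it never stops. -/
theorem alphaSeq_notMem [CharZero K] (p : ℕ) [Fact p.Prime] (σinf : K →+* ℝ) (σp : K →+* ℚ_[p])
    {α : K} (hα : α ∉ Set.range (algebraMap ℚ K)) (n : ℕ) :
    alphaSeq p σinf σp α n ∉ Set.range (algebraMap ℚ K) := by
  induction n with
  | zero => exact hα
  | succ n ih =>
    cases n with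
    | zero => exact hα
    | succ n =>
      rintro ⟨r, hr⟩
      refine ih ⟨1 / (r + partialQuot p σinf σp (tau (n + 1)) (alphaSeq p σinf σp α (n + 1))), ?_⟩
      simp only [alphaSeq, T, eq_ratCast] at hr
      simp only [eq_ratCast, Rat.cast_div, Rat.cast_one, Rat.cast_add, hr]
      simp

theorem alphaSeq_ne_zero [CharZero K] (p : ℕ) [Fact p.Prime] (σinf : K →+* ℝ) (σp : K →+* ℚ_[p])
    {α : K} (hα : α ∉ Set.range (algebraMap ℚ K)) (n : ℕ) :
    alphaSeq p σinf σp α n ≠ 0 :=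
  fun h => alphaSeq_notMem p σinf σp hα n ⟨0, by simp [h]⟩

theorem step_pos (p : ℕ) [Fact p.Prime] (ε : ℕ) : 0 < step p ε := by
  unfold step
  split_ifs
  · exact (Fact.out : p.Prime).pos
  · exact one_pos

theorem tau_succ (n : ℕ) : tau ((n : ℤ) + 1) = 1 - tau n := by
  unfold tau
  by_cases h : Even (n : ℤ) <;> simp only [Int.even_add_one, h] <;> simp

/-- `v_p(T_{p,1}(α)) ≥ 0` and `v_p(T_{p,0}(α)) > 0`. -/
theorem norm_T (p : ℕ) [Fact p.Prime] (σinf : K →+* ℝ) (σp : K →+* ℚ_[p]) (ε : ℕ) (α : K) :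
    ‖σp (T p σinf σp ε α)‖ ≤ 1 ∧ (ε = 0 → ‖σp (T p σinf σp ε α)‖ < 1) := by
  have h1 := norm_sub_padicFloor_lt p (σp (1 / α))
  set m := nearestIndex (σinf (1 / α) - (padicFloor p (σp (1 / α)) : ℝ)) (step p ε)
  have h2 : ‖(m : ℚ_[p])‖ ≤ 1 := Padic.norm_int_le_one m
  have h3 : ‖(step p ε : ℚ_[p])‖ ≤ 1 := by exact_mod_cast Padic.norm_int_le_one (step p ε : ℤ)
  have e : σp (T p σinf σp ε α) = (σp (1 / α) - (padicFloor p (σp (1 / α)) : ℚ_[p]))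
      - m * (step p ε : ℚ_[p]) := by
    simp only [T, partialQuot, map_sub, map_ratCast]
    push_cast
    ring
  have h4 : ‖(m : ℚ_[p]) * (step p ε : ℚ_[p])‖ ≤ ‖(step p ε : ℚ_[p])‖ := by
    rw [norm_mul]; exact mul_le_of_le_one_left (norm_nonneg _) h2
  rw [e, sub_eq_add_neg]
  refine ⟨(Padic.nonarchimedean _ _).trans (max_le h1.le ?_), fun hε =>
    (Padic.nonarchimedean _ _).trans_lt (max_lt h1 ?_)⟩
  · rw [norm_neg]; exact h4.trans h3
  · rw [norm_neg]
    refine h4.trans_lt ?_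
    simpa [step, hε] using Padic.norm_p_lt_one (p := p)

theorem norm_lt_one_of_addValuation_pos (p : ℕ) [Fact p.Prime] {x : ℚ_[p]}
    (h : 0 < Padic.addValuation x) : ‖x‖ < 1 := by
  rcases eq_or_ne x 0 with rfl | hx
  · simp
  · rw [Padic.addValuation.apply hx] at h
    have h' : 0 < x.valuation := by exact_mod_cast h
    rw [Padic.norm_eq_zpow_neg_valuation hx]
    exact zpow_lt_one_of_neg₀ (by exact_mod_cast (Fact.out : p.Prime).one_lt) (by omega)

theorem norm_alphaSeq (p : ℕ) [Fact p.Prime] (σinf : K →+* ℝ) (σp : K →+* ℚ_[p])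
    {α : K} (hI : PropertyI p σinf σp α) (n : ℕ) :
    ‖σp (alphaSeq p σinf σp α (n + 1))‖ ≤ 1 ∧
      (tau (n + 1) = 1 → ‖σp (alphaSeq p σinf σp α (n + 1))‖ < 1) := by
  cases n with
  | zero =>
    have h := norm_lt_one_of_addValuation_pos p hI.2
    exact ⟨h.le, fun _ => h⟩
  | succ n =>
    refine ⟨(norm_T _ _ _ _ _).1, fun h => (norm_T _ _ _ _ _).2 ?_⟩
    have := tau_succ (n + 1)
    push_cast at this h
    omega

/-- `v_p(a_n(α)) = -v_p(α_{(n)})`; it is `≤ 0`, and `< 0` for odd `n`. -/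
theorem norm_aSeq [CharZero K] (p : ℕ) [Fact p.Prime] (σinf : K →+* ℝ) (σp : K →+* ℚ_[p])
    {α : K} (hα : α ∉ Set.range (algebraMap ℚ K)) (hI : PropertyI p σinf σp α) (n : ℕ) :
    1 ≤ ‖(aSeq p σinf σp α (n + 1) : ℚ_[p])‖ ∧
      (tau (n + 1) = 1 → 1 < ‖(aSeq p σinf σp α (n + 1) : ℚ_[p])‖) := by
  obtain ⟨h1, h2⟩ := norm_alphaSeq p σinf σp hI n
  set x := alphaSeq p σinf σp α (n + 1) with hx
  have hx0 : x ≠ 0 := alphaSeq_ne_zero p σinf σp hα (n + 1)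
  have hσ : 0 < ‖σp x‖ := by simpa using hx0
  obtain ⟨h3, h4⟩ := norm_T p σinf σp (tau (n + 1)) x
  have e : (aSeq p σinf σp α (n + 1) : ℚ_[p])
      = (σp x)⁻¹ + -σp (T p σinf σp (tau (n + 1)) x) := by
    simp [aSeq, T, ← hx]
  have hlt : ‖-σp (T p σinf σp (tau (n + 1)) x)‖ < ‖(σp x)⁻¹‖ := by
    rw [norm_neg, norm_inv]
    by_cases ht : tau ((n : ℤ) + 1) = 0
    · exact (h4 ht).trans_le (one_le_inv_iff₀.2 ⟨hσ, h1⟩)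
    · have : tau ((n : ℤ) + 1) = 1 := by
        unfold tau at ht ⊢
        split_ifs at ht ⊢ <;> simp_all
      exact h3.trans_lt ((one_lt_inv_iff₀).2 ⟨hσ, h2 this⟩)
  rw [e, Padic.add_eq_max_of_ne hlt.ne', max_eq_left hlt.le, norm_inv]
  exact ⟨one_le_inv_iff₀.2 ⟨hσ, h1⟩, fun h => (one_lt_inv_iff₀).2 ⟨hσ, h2 h⟩⟩

/-- `a_n(α) = p^(v_p(a_n(α))) c` with `v_p(a_n(α)) ≤ 0` (`< 0` for odd `n`), `c ∈ ℤ`, `p ∤ c`. -/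
theorem aSeq_eq [CharZero K] (p : ℕ) [Fact p.Prime] (σinf : K →+* ℝ) (σp : K →+* ℚ_[p])
    {α : K} (hα : α ∉ Set.range (algebraMap ℚ K)) (hI : PropertyI p σinf σp α) (n : ℕ) :
    ∃ (e : ℕ) (c : ℤ), padicValRat p (aSeq p σinf σp α (n + 1)) = -e ∧ ¬ (p : ℤ) ∣ c ∧
      (tau (n + 1) = 1 → 0 < e) ∧ (p : ℚ) ^ e * aSeq p σinf σp α (n + 1) = c := by
  obtain ⟨h1, h2⟩ := norm_aSeq p σinf σp hα hI n
  have hp1 : (1 : ℝ) < p := by exact_mod_cast (Fact.out : p.Prime).one_lt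
  have hpq : (p : ℚ) ≠ 0 := by exact_mod_cast (Fact.out : p.Prime).ne_zero
  set a := aSeq p σinf σp α (n + 1) with ha
  have ha0 : (a : ℚ_[p]) ≠ 0 := by
    intro h; rw [h, norm_zero] at h1; linarith
  rw [Padic.norm_eq_zpow_neg_valuation ha0, Padic.valuation_ratCast] at h1 h2
  have hv : 0 ≤ -padicValRat p a := by
    by_contra hc
    exact absurd h1 (not_le.2 (zpow_lt_one_of_neg₀ hp1 (by omega)))
  obtain ⟨e, he⟩ := Int.eq_ofNat_of_zero_le hv
  -- `p^k a` is an integer for some `k`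
  obtain ⟨k, z, hz⟩ : ∃ (k : ℕ) (z : ℤ), (p : ℚ) ^ k * a = z := by
    rw [ha, aSeq, partialQuot]
    generalize σp (1 / alphaSeq p σinf σp α (n + 1)) = u
    generalize nearestIndex _ _ = m
    generalize step p _ = s
    suffices h : ∃ (k : ℕ) (z : ℤ), (p : ℚ) ^ k * padicFloor p u = z by
      obtain ⟨k, z, hz⟩ := h
      refine ⟨k, p ^ k * (m * s) + z, ?_⟩
      rw [mul_add, hz]; push_cast; ring
    refine ⟨(-u.valuation).toNat, ∑ i ∈ Finset.Icc u.valuation 0,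
      (padicDigit p u i : ℤ) * p ^ ((-u.valuation).toNat + i).toNat, ?_⟩
    rw [padicFloor, Finset.mul_sum]
    push_cast
    refine Finset.sum_congr rfl fun i hi => ?_
    rw [Finset.mem_Icc] at hi
    rw [← zpow_natCast (p : ℚ) (((-u.valuation).toNat : ℤ) + i).toNat,
      Int.toNat_of_nonneg (by omega), zpow_add₀ hpq, zpow_natCast]
    ring
  have hb : ‖(((p : ℚ) ^ e * a : ℚ) : ℚ_[p])‖ = 1 := by
    push_cast
    rw [norm_mul, Padic.norm_eq_zpow_neg_valuation ha0, Padic.valuation_ratCast, he,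
      Padic.norm_p_pow, ← zpow_add₀ (by linarith)]
    simp
  obtain ⟨c, hc⟩ : ∃ c : ℤ, (p : ℚ) ^ e * a = c := by
    have hd : (p : ℤ) ^ k ∣ z * p ^ e := by
      rw [← Padic.norm_int_le_pow_iff_dvd]
      have h5 : ((z * p ^ e : ℤ) : ℚ_[p]) = (p : ℚ_[p]) ^ k * (((p : ℚ) ^ e * a : ℚ) : ℚ_[p]) := by
        have : ((z * p ^ e : ℤ) : ℚ) = (p : ℚ) ^ k * ((p : ℚ) ^ e * a) := by
          push_cast; rw [← hz]; ring
        exact_mod_cast congrArg (fun t : ℚ => (t : ℚ_[p])) this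
      rw [h5, norm_mul, hb, Padic.norm_p_pow, mul_one]
    obtain ⟨c, hc⟩ := hd
    refine ⟨c, mul_left_cancel₀ (pow_ne_zero k hpq) ?_⟩
    have hc' : (z : ℚ) * p ^ e = p ^ k * c := by exact_mod_cast hc
    rw [← hc', ← hz]; ring
  refine ⟨e, c, by omega, ?_, ?_, hc⟩
  · rw [← Padic.norm_intCast_lt_one_iff]
    rw [hc] at hb
    have : ‖(c : ℚ_[p])‖ = 1 := by exact_mod_cast hb
    linarith
  · intro h
    rcases Nat.eq_zero_or_pos e with h0 | h0
    · have := h2 h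
      rw [he, h0] at this
      simp at this
    · exact h0

/-- `p'_n` and `q'_n` are integers, `q'_n ≠ 0`, and they are coprime. -/
theorem exists_int_convergent [CharZero K] (p : ℕ) [Fact p.Prime] (σinf : K →+* ℝ)
    (σp : K →+* ℚ_[p]) {α : K} (hα : α ∉ Set.range (algebraMap ℚ K))
    (hI : PropertyI p σinf σp α) (n : ℕ) :
    ∃ P Q : ℤ, convNum' p σinf σp α n = P ∧ convDen' p σinf σp α n = Q ∧ Q ≠ 0 ∧
      IsCoprime P Q := by
  have hpr : Prime (p : ℤ) := Nat.prime_iff_prime_int.1 Fact.out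
  have hpq : (p : ℚ) ≠ 0 := by exact_mod_cast (Fact.out : p.Prime).ne_zero
  have main : ∃ (A B P Q : ℤ) (k : ℕ),
      convScale p σinf σp α n * convMatrix p σinf σp α n 0 0 = A ∧
      convScale p σinf σp α n * convMatrix p σinf σp α n 1 0 = B ∧
      convNum' p σinf σp α n = P ∧ convDen' p σinf σp α n = Q ∧
      (A * Q - P * B = p ^ k ∨ A * Q - P * B = -p ^ k) ∧
      ¬ (p : ℤ) ∣ Q ∧ (tau n = 1 ∨ n = 0 → (p : ℤ) ∣ B) := by
    induction n with
    | zero =>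
      refine ⟨1, 0, 0, 1, 0, ?_⟩
      simp [convScale, convNum', convDen', convNum, convDen, convMatrix]
      exact fun h => hpr.not_isUnit (isUnit_of_dvd_one h)
    | succ n ih =>
      obtain ⟨A, B, P, Q, k, hA, hB, hP, hQ, hdet, hndvd, hdvd⟩ := ih
      obtain ⟨e, c, hv, hc, he, hac⟩ := aSeq_eq p σinf σp hα hI n
      have hs : convScale p σinf σp α (n + 1) = (p : ℚ) ^ e * convScale p σinf σp α n := by
        rw [convScale, Finset.sum_Icc_succ_top (by omega), hv, neg_add, neg_neg, zpow_add₀ hpq,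
          zpow_natCast, convScale, mul_comm]
      simp only [convNum', convDen', convNum, convDen] at hP hQ ⊢
      refine ⟨p ^ e * P, p ^ e * Q, p ^ e * A + c * P, p ^ e * B + c * Q, k + 2 * e,
        ?_, ?_, ?_, ?_, ?_, ?_, ?_⟩
      · rw [hs]; simp [convMatrix, Matrix.mul_apply, ← hP]; ring
      · rw [hs]; simp [convMatrix, Matrix.mul_apply, ← hQ]; ring
      · rw [hs]; simp [convMatrix, Matrix.mul_apply, ← hP, ← hA, ← hac]; ring
      · rw [hs]; simp [convMatrix, Matrix.mul_apply, ← hQ, ← hB, ← hac]; ring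
      · rcases hdet with h | h
        · right; linear_combination (-(p : ℤ) ^ (2 * e)) * h
        · left; linear_combination (-(p : ℤ) ^ (2 * e)) * h
      · have hd : (p : ℤ) ∣ p ^ e * B := by
          by_cases ht : tau ((n : ℤ) + 1) = 1
          · exact Dvd.dvd.mul_right (dvd_pow_self _ (he ht).ne') _
          · refine Dvd.dvd.mul_left (hdvd (Or.inl ?_)) _
            have h1 := tau_succ n
            have h2 : tau (n : ℤ) ≤ 1 := by
              unfold tau; split_ifs <;> omega
            omega
        intro h
        rcases hpr.dvd_or_dvd ((Int.dvd_add_right hd).1 h) with h | h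
        · exact hc h
        · exact hndvd h
      · intro h
        have ht : tau ((n : ℤ) + 1) = 1 := by
          rcases h with h | h
          · exact_mod_cast h
          · omega
        exact Dvd.dvd.mul_right (dvd_pow_self _ (he ht).ne') _
  obtain ⟨A, B, P, Q, k, -, -, hP, hQ, hdet, hndvd, -⟩ := main
  refine ⟨P, Q, hP, hQ, fun h => hndvd (h ▸ dvd_zero _), ?_⟩
  have hpQ : IsCoprime ((p : ℤ) ^ k) Q :=
    IsCoprime.pow_left ((Prime.coprime_iff_not_dvd hpr).2 hndvd)
  obtain ⟨x, y, hxy⟩ := hpQ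
  rcases hdet with h | h
  · exact ⟨-x * B, x * A + y, by linear_combination hxy + x * h⟩
  · exact ⟨x * B, -x * A + y, by linear_combination hxy - x * h⟩

end

end PadicRealCF

namespace PadicRealCF

variable {K : Type*} [Field K]

/-! Write α_k for `alphaSeq` and s = 2/(1+τ(n)) for the step used at time n. Telescoping gives two
identities in K: p_n - α q_n = ∏_{k≤n+1} (-α_k), and q_n + α_{n+1} q_{n-1} = ∏_{k≤n} α_k⁻¹. The
scaling factor S = `convScale` equals ∏_{k≤n} |α_k|_p⁻¹ and is a power of p, so |S|_p = S⁻¹;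
moreover q'_n is a p-adic unit for n ≥ 1. When the error is multiplied by |q'_n|², all powers of S
cancel, leaving (|q_n| ∏_{k≤n} |α_k|_∞) · |α_{n+1}|_∞ · |α_{n+1}|_p.

Upper bounds, p = 2: rounding gives |α_{n+1}|_∞ < s/2. The steps alternate between 2 and 1, so two
consecutive real factors have product below 1/2, which keeps the bracket below 2
(`abs_convDen_mul_prod_lt`). Since |α_{n+1}|_2 = |a_{n+1}|_2⁻¹, the scaled error is below
s/|a_{n+1}|_2, and this is at most 1 because |a_{n+1}|_2 ≥ s (`step_le_norm_aSeq`).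

Lower bound: α is a root of an integral quadratic, whose binary form takes a nonzero integer value N
at (p'_n, q'_n). Then 1 ≤ |N|_∞ |N|_2, and N has the factor p'_n - α q'_n
(`one_le_of_int_quadratic`). The geometric decay of ∏ |α_k|_∞ makes the remaining term negligible
for large n; the finitely many other n only shrink the constant. -/

/-- The chosen index does at least as well as `round (t / s)`, which is within s/2 of t after
scaling by s. -/
theorem abs_T_le (p : ℕ) [Fact p.Prime] (σinf : K →+* ℝ) (σp : K →+* ℚ_[p]) (ε : ℕ) (x : K) :
    |σinf (T p σinf σp ε x)| ≤ (step p ε : ℝ) / 2 := by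
  have hs : (0 : ℝ) < step p ε := by exact_mod_cast step_pos p ε
  have e : σinf (T p σinf σp ε x) = (σinf (1 / x) - (padicFloor p (σp (1 / x)) : ℝ))
      - nearestIndex (σinf (1 / x) - (padicFloor p (σp (1 / x)) : ℝ)) (step p ε)
        * (step p ε : ℝ) := by
    simp only [T, partialQuot, map_sub, map_ratCast]
    push_cast
    ring
  rw [e]
  generalize σinf (1 / x) - (padicFloor p (σp (1 / x)) : ℝ) = t
  refine ((isLeast_nearestIndex t _ (step_pos p ε)).1 (round (t / step p ε))).trans ?_
  have h : t - round (t / step p ε) * (step p ε : ℝ)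
      = (t / step p ε - round (t / step p ε)) * step p ε := by
    rw [sub_mul, div_mul_cancel₀ _ hs.ne']
  rw [h, abs_mul, abs_of_pos hs]
  have := abs_sub_round (t / step p ε)
  nlinarith

/-! ### Product formulas and p-adic sizes, for a general prime p -/

section

variable (p : ℕ) [Fact p.Prime] (σinf : K →+* ℝ) (σp : K →+* ℚ_[p]) {α : K}

theorem aSeq_cast_add_alphaSeq (n : ℕ) :
    (aSeq p σinf σp α (n + 1) : K) + alphaSeq p σinf σp α (n + 2)
      = (alphaSeq p σinf σp α (n + 1))⁻¹ := by
  simp [aSeq, alphaSeq, T]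

theorem convDen_succ (n : ℕ) : convDen p σinf σp α (n + 1)
    = convMatrix p σinf σp α n 1 0 + aSeq p σinf σp α (n + 1) * convDen p σinf σp α n := by
  simp [convDen, convMatrix, Matrix.mul_apply, mul_comm]

theorem convNum_succ (n : ℕ) : convNum p σinf σp α (n + 1)
    = convMatrix p σinf σp α n 0 0 + aSeq p σinf σp α (n + 1) * convNum p σinf σp α n := by
  simp [convNum, convMatrix, Matrix.mul_apply, mul_comm]

theorem convMatrix_succ_one_zero (n : ℕ) :
    convMatrix p σinf σp α (n + 1) 1 0 = convDen p σinf σp α n := by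
  simp [convDen, convMatrix, Matrix.mul_apply]

theorem convMatrix_succ_zero_zero (n : ℕ) :
    convMatrix p σinf σp α (n + 1) 0 0 = convNum p σinf σp α n := by
  simp [convNum, convMatrix, Matrix.mul_apply]

theorem norm_convScale (n : ℕ) :
    ‖(convScale p σinf σp α n : ℚ_[p])‖ = (convScale p σinf σp α n : ℝ)⁻¹ := by
  rw [convScale]
  push_cast
  rw [Padic.norm_p_zpow, zpow_neg]

theorem convScale_pos (n : ℕ) : 0 < convScale p σinf σp α n :=
  zpow_pos (by exact_mod_cast (Fact.out : p.Prime).pos) _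

variable [CharZero K]

/-- Rounding, or property I for the first term, gives ≤. Equality would make a term of the sequence
rational, since σinf is injective. The term of index n + 1 is produced with step parameter τ(n);
τ(0) = 0 matches the interval in property I. -/
theorem abs_alphaSeq_lt (hα : α ∉ Set.range (algebraMap ℚ K)) (hI : PropertyI p σinf σp α)
    (n : ℕ) : |σinf (alphaSeq p σinf σp α (n + 1))| < (step p (tau n) : ℝ) / 2 := by
  refine lt_of_le_of_ne ?_ fun h => ?_
  · cases n with
    | zero =>
      have h := hI.1
      simp only [Set.mem_Ioc] at h
      simp only [alphaSeq, step, tau]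
      exact abs_le.2 ⟨by simp; linarith, by simpa using h.2⟩
    | succ n => exact_mod_cast abs_T_le p σinf σp (tau (n + 1)) (alphaSeq p σinf σp α (n + 1))
  · have hrat := alphaSeq_notMem p σinf σp hα (n + 1)
    rcases eq_or_eq_neg_of_abs_eq h with h | h
    · exact hrat ⟨(step p (tau n) : ℚ) / 2, σinf.injective (by
        rw [h, eq_ratCast, map_ratCast]; push_cast; rfl)⟩
    · exact hrat ⟨-((step p (tau n) : ℚ) / 2), σinf.injective (by
        rw [h, eq_ratCast, map_ratCast]; push_cast; rfl)⟩

/-- `q_n + α_{(n+1)} q_{n-1} = ∏_{k ≤ n} α_{(k)}⁻¹`. -/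
theorem convDen_add_alphaSeq_mul (hα : α ∉ Set.range (algebraMap ℚ K)) (n : ℕ) :
    (convDen p σinf σp α n : K) + alphaSeq p σinf σp α (n + 1) * convMatrix p σinf σp α n 1 0
      = ∏ k ∈ Finset.range n, (alphaSeq p σinf σp α (k + 1))⁻¹ := by
  induction n with
  | zero => simp [convDen, convMatrix]
  | succ n ih =>
    have h0 := alphaSeq_ne_zero p σinf σp hα (n + 1)
    rw [Finset.prod_range_succ, ← ih, ← aSeq_cast_add_alphaSeq, convMatrix_succ_one_zero,
      convDen_succ]
    have h := aSeq_cast_add_alphaSeq p σinf σp (α := α) n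
    have h' : ((aSeq p σinf σp α (n + 1) : K) + alphaSeq p σinf σp α (n + 2))
        * alphaSeq p σinf σp α (n + 1) = 1 := by rw [h, inv_mul_cancel₀ h0]
    push_cast
    linear_combination -(convMatrix p σinf σp α n 1 0 : K) * h'

/-- `p_n - α q_n = ∏_{k ≤ n+1} (-α_{(k)})`. -/
theorem convNum_sub_mul_convDen (hα : α ∉ Set.range (algebraMap ℚ K)) (n : ℕ) :
    (convNum p σinf σp α n : K) - α * convDen p σinf σp α n
      = ∏ k ∈ Finset.range (n + 1), -alphaSeq p σinf σp α (k + 1) := by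
  -- This says that α is the image of α_{n+1} under the Möbius map of the convergent matrix. It
  -- yields the ratio -α_{n+1} between consecutive values of p_n - α q_n. The first matrix column
  -- serves as p_{n-1}, q_{n-1}, so that n = 0 is covered by the identity matrix.
  have h : ∀ n, ((convNum p σinf σp α n : K) - α * convDen p σinf σp α n)
      + alphaSeq p σinf σp α (n + 1)
        * ((convMatrix p σinf σp α n 0 0 : K) - α * convMatrix p σinf σp α n 1 0) = 0 := by
    intro n
    induction n with
    | zero => simp [convNum, convDen, convMatrix, alphaSeq]
    | succ n ih =>
      have h0 := alphaSeq_ne_zero p σinf σp hα (n + 1)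
      have h' : ((aSeq p σinf σp α (n + 1) : K) + alphaSeq p σinf σp α (n + 2))
          * alphaSeq p σinf σp α (n + 1) = 1 := by
        rw [aSeq_cast_add_alphaSeq, inv_mul_cancel₀ h0]
      rw [convMatrix_succ_one_zero, convMatrix_succ_zero_zero, convDen_succ, convNum_succ]
      refine (mul_eq_zero.1 ?_).resolve_left h0
      push_cast
      linear_combination ih + ((convNum p σinf σp α n : K) - α * convDen p σinf σp α n) * h'
  induction n with
  | zero => simp [convNum, convDen, convMatrix, alphaSeq]
  | succ n ih =>
    rw [Finset.prod_range_succ, ← ih]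
    have := h (n + 1)
    rw [convMatrix_succ_one_zero, convMatrix_succ_zero_zero] at this
    linear_combination this

/-- `|a_n|_p = |α_{(n)}|_p⁻¹`. -/
theorem norm_aSeq_eq (hα : α ∉ Set.range (algebraMap ℚ K)) (hI : PropertyI p σinf σp α) (n : ℕ) :
    ‖(aSeq p σinf σp α (n + 1) : ℚ_[p])‖ = ‖σp (alphaSeq p σinf σp α (n + 1))‖⁻¹ := by
  obtain ⟨h1, h2⟩ := norm_aSeq p σinf σp hα hI n
  obtain ⟨h3, h4⟩ := norm_T p σinf σp (tau (n + 1)) (alphaSeq p σinf σp α (n + 1))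
  set t := T p σinf σp (tau (n + 1)) (alphaSeq p σinf σp α (n + 1)) with ht
  have e : (σp (alphaSeq p σinf σp α (n + 1)))⁻¹ = (aSeq p σinf σp α (n + 1) : ℚ_[p]) + σp t := by
    simp [aSeq, ht, T]
  -- For either parity exactly one of the bounds |t|_p ≤ 1 ≤ |a|_p is known to be strict, so a
  -- dominates in the ultrametric sum.
  have hlt : ‖σp t‖ < ‖(aSeq p σinf σp α (n + 1) : ℚ_[p])‖ := by
    by_cases h : tau ((n : ℤ) + 1) = 0
    · exact (h4 h).trans_le h1
    · have : tau ((n : ℤ) + 1) = 1 := by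
        unfold tau at h ⊢
        split_ifs at h ⊢ <;> simp_all
      exact h3.trans_lt (h2 this)
  rw [← norm_inv, e, Padic.add_eq_max_of_ne hlt.ne', max_eq_left hlt.le]

/-- `|a_{n+1}|_p ≥ p` for even `n`. -/
theorem step_le_norm_aSeq (hα : α ∉ Set.range (algebraMap ℚ K)) (hI : PropertyI p σinf σp α)
    (n : ℕ) : (step p (tau n) : ℝ) ≤ ‖(aSeq p σinf σp α (n + 1) : ℚ_[p])‖ := by
  obtain ⟨h1, -⟩ := norm_aSeq p σinf σp hα hI n
  by_cases h : tau (n : ℤ) = 0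
  · obtain ⟨e, c, hv, -, he, -⟩ := aSeq_eq p σinf σp hα hI n
    -- If n is even then n + 1 is odd, where the valuation of the partial quotient is strictly
    -- negative.
    have he0 : e ≠ 0 := (he (by rw [tau_succ, h])).ne'
    have ha : (aSeq p σinf σp α (n + 1) : ℚ_[p]) ≠ 0 := fun h0 => by
      rw [h0, norm_zero] at h1
      linarith
    have hp : (1 : ℝ) ≤ p := by exact_mod_cast (Fact.out : p.Prime).one_le
    rw [Padic.norm_eq_zpow_neg_valuation ha, Padic.valuation_ratCast, hv, neg_neg, zpow_natCast]
    simpa [step, h] using le_self_pow₀ hp he0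
  · simpa [step, h] using h1

theorem convScale_cast_eq (hα : α ∉ Set.range (algebraMap ℚ K)) (hI : PropertyI p σinf σp α)
    (n : ℕ) : (convScale p σinf σp α n : ℝ)
      = ∏ k ∈ Finset.range n, ‖σp (alphaSeq p σinf σp α (k + 1))‖⁻¹ := by
  have hp : (p : ℝ) ≠ 0 := by exact_mod_cast (Fact.out : p.Prime).ne_zero
  induction n with
  | zero => simp [convScale]
  | succ n ih =>
    have ha : (aSeq p σinf σp α (n + 1) : ℚ_[p]) ≠ 0 := by
      intro h
      have := (norm_aSeq p σinf σp hα hI n).1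
      rw [h, norm_zero] at this
      linarith
    rw [Finset.prod_range_succ, ← ih, ← norm_aSeq_eq p σinf σp hα hI,
      Padic.norm_eq_zpow_neg_valuation ha, Padic.valuation_ratCast, convScale, convScale,
      Finset.sum_Icc_succ_top (by omega)]
    push_cast
    rw [neg_add, zpow_add₀ hp]

/-- `|p'_n - α q'_n|_p = |α_{(n+1)}|_p p^(2 ∑ v_p(a_s))`. -/
theorem norm_convNum'_sub (hα : α ∉ Set.range (algebraMap ℚ K)) (hI : PropertyI p σinf σp α)
    (n : ℕ) : ‖(convNum' p σinf σp α n : ℚ_[p]) - σp α * convDen' p σinf σp α n‖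
      = ‖σp (alphaSeq p σinf σp α (n + 1))‖ * ((convScale p σinf σp α n : ℝ)⁻¹) ^ 2 := by
  have h := congrArg σp (convNum_sub_mul_convDen p σinf σp hα n)
  simp only [map_sub, map_mul, map_ratCast, map_prod, map_neg] at h
  have e : (convNum' p σinf σp α n : ℚ_[p]) - σp α * convDen' p σinf σp α n
      = convScale p σinf σp α n
        * ∏ k ∈ Finset.range (n + 1), -σp (alphaSeq p σinf σp α (k + 1)) := by
    rw [← h, convNum', convDen']
    push_cast
    ring
  rw [e, norm_mul, norm_convScale, norm_prod, Finset.prod_range_succ]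
  have h2 : ∏ k ∈ Finset.range n, ‖-σp (alphaSeq p σinf σp α (k + 1))‖
      = (convScale p σinf σp α n : ℝ)⁻¹ := by
    rw [convScale_cast_eq p σinf σp hα hI, ← Finset.prod_inv_distrib]
    simp
  rw [h2, norm_neg]
  ring

theorem abs_convNum'_sub (hα : α ∉ Set.range (algebraMap ℚ K)) (n : ℕ) :
    |(convNum' p σinf σp α n : ℝ) - σinf α * convDen' p σinf σp α n|
      = convScale p σinf σp α n
        * ∏ k ∈ Finset.range (n + 1), |σinf (alphaSeq p σinf σp α (k + 1))| := by
  have h := congrArg σinf (convNum_sub_mul_convDen p σinf σp hα n)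
  simp only [map_sub, map_mul, map_ratCast, map_prod, map_neg] at h
  have e : (convNum' p σinf σp α n : ℝ) - σinf α * convDen' p σinf σp α n
      = convScale p σinf σp α n
        * ∏ k ∈ Finset.range (n + 1), -σinf (alphaSeq p σinf σp α (k + 1)) := by
    rw [← h, convNum', convDen']
    push_cast
    ring
  have hs : (0 : ℝ) < convScale p σinf σp α n := by exact_mod_cast convScale_pos p σinf σp n
  rw [e, abs_mul, abs_of_pos hs, Finset.abs_prod]
  simp

/-- The factor |a_1|_p already exceeds 1, and every later factor is at least 1. -/
theorem one_lt_convScale (hα : α ∉ Set.range (algebraMap ℚ K)) (hI : PropertyI p σinf σp α)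
    {n : ℕ} (hn : 0 < n) : (1 : ℝ) < convScale p σinf σp α n := by
  obtain ⟨n, rfl⟩ := Nat.exists_eq_add_of_lt hn
  rw [zero_add, convScale_cast_eq p σinf σp hα hI]
  induction n with
  | zero =>
    have h := (norm_aSeq p σinf σp hα hI 0).2 (by simp [tau])
    rw [norm_aSeq_eq p σinf σp hα hI] at h
    simpa using h
  | succ n ih =>
    rw [Finset.prod_range_succ, ← norm_aSeq_eq p σinf σp hα hI (n + 1)]
    exact one_lt_mul_of_lt_of_le (ih (by omega)) (norm_aSeq p σinf σp hα hI (n + 1)).1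

/-- If p divided q'_n, then p'_n = (p'_n - α q'_n) + α q'_n would be a sum of two terms of norm
below 1, so p would divide p'_n as well, against coprimality. -/
theorem norm_convDen' (hα : α ∉ Set.range (algebraMap ℚ K)) (hI : PropertyI p σinf σp α)
    {n : ℕ} (hn : 0 < n) : ‖(convDen' p σinf σp α n : ℚ_[p])‖ = 1 := by
  obtain ⟨P, Q, hP, hQ, -, hPQ⟩ := exists_int_convergent p σinf σp hα hI n
  have hE := norm_convNum'_sub p σinf σp hα hI n
  have hS := one_lt_convScale p σinf σp hα hI hn
  have hlt : ‖(convNum' p σinf σp α n : ℚ_[p]) - σp α * convDen' p σinf σp α n‖ < 1 := by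
    rw [hE]
    have h1 := (norm_alphaSeq p σinf σp hI n).1
    have h2 : ((convScale p σinf σp α n : ℝ)⁻¹) ^ 2 < 1 :=
      pow_lt_one₀ (by positivity) (inv_lt_one_of_one_lt₀ hS) two_ne_zero
    exact mul_lt_one_of_nonneg_of_lt_one_right h1 (by positivity) h2
  have hα1 := norm_lt_one_of_addValuation_pos p hI.2
  rw [hP, hQ] at hlt
  rw [hQ]
  simp only [Rat.cast_intCast] at hlt ⊢
  refine (Padic.norm_int_le_one Q).antisymm (not_lt.1 fun hQ1 => ?_)
  have hP1 : ‖(P : ℚ_[p])‖ < 1 := by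
    have e : (P : ℚ_[p]) = ((P : ℚ_[p]) - σp α * Q) + σp α * Q := by ring
    rw [e]
    refine (Padic.nonarchimedean _ _).trans_lt (max_lt hlt ?_)
    rw [norm_mul]
    exact mul_lt_one_of_nonneg_of_lt_one_left (norm_nonneg _) hα1 hQ1.le
  have hpr : Prime (p : ℤ) := Nat.prime_iff_prime_int.1 Fact.out
  exact hpr.not_isUnit (hPQ.isUnit_of_dvd' ((Padic.norm_intCast_lt_one_iff).1 hP1)
    ((Padic.norm_intCast_lt_one_iff).1 hQ1))

end

/-! ### Quadratic irrationals: the lower bound from a binary form -/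

/-- An irrational element of a quadratic field is a root of an integral quadratic polynomial. -/
theorem exists_int_quadratic [NumberField K] (hK : Module.finrank ℚ K = 2) {α : K}
    (hα : α ∉ Set.range (algebraMap ℚ K)) :
    ∃ A B C : ℤ, A ≠ 0 ∧ (A : K) * α ^ 2 + B * α + C = 0 := by
  -- Three vectors in a plane over ℚ are dependent, and independence over ℤ is equivalent to
  -- independence over its fraction field.
  have h : ¬ LinearIndependent ℤ ![α ^ 2, α, 1] := by
    rw [LinearIndependent.iff_fractionRing ℤ ℚ]
    intro h
    have := h.fintype_card_le_finrank
    simp [hK] at this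
  obtain ⟨g, hg, i, hi⟩ := Fintype.not_linearIndependent_iff.1 h
  simp only [Fin.sum_univ_three, Matrix.cons_val_zero, Matrix.cons_val_one, Matrix.cons_val,
    zsmul_eq_mul, mul_one] at hg
  refine ⟨g 0, g 1, g 2, fun h0 => ?_, hg⟩
  rw [h0] at hg
  simp only [Int.cast_zero, zero_mul, zero_add] at hg
  by_cases h1 : g 1 = 0
  · rw [h1] at hg
    have h2 : g 2 = 0 := by simpa using hg
    fin_cases i <;> simp_all
  · refine hα ⟨-(g 2 : ℚ) / g 1, ?_⟩
    have h1' : (g 1 : K) ≠ 0 := by exact_mod_cast h1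
    simp only [eq_ratCast, Rat.cast_div, Rat.cast_neg, Rat.cast_intCast]
    rw [div_eq_iff h1']
    linear_combination -hg

/-- The product is |N| divided by the exact power of p in N, which is a positive integer. -/
theorem one_le_abs_mul_norm_intCast (p : ℕ) [Fact p.Prime] {N : ℤ} (hN : N ≠ 0) :
    1 ≤ |(N : ℝ)| * ‖(N : ℚ_[p])‖ := by
  have hp : (0 : ℝ) < p := by exact_mod_cast (Fact.out : p.Prime).pos
  have hN' : (N : ℚ_[p]) ≠ 0 := by exact_mod_cast hN
  rw [Padic.norm_eq_zpow_neg_valuation hN', Padic.valuation_intCast, zpow_neg, zpow_natCast,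
    ← div_eq_mul_inv, one_le_div (by positivity)]
  have h : ((p : ℤ) ^ padicValInt p N) ∣ N := padicValInt_dvd N
  have h' := Int.le_of_dvd (abs_pos.2 hN) ((dvd_abs _ _).2 h)
  exact_mod_cast h'

/-- A quadratic irrational is badly approximable with respect to `∞` and `p` jointly. -/
theorem one_le_of_int_quadratic [CharZero K] (p : ℕ) [Fact p.Prime] (σinf : K →+* ℝ)
    (σp : K →+* ℚ_[p]) {α : K} (hα : α ∉ Set.range (algebraMap ℚ K)) (hα1 : ‖σp α‖ ≤ 1)
    {A B C : ℤ} (hA : A ≠ 0) (h : (A : K) * α ^ 2 + B * α + C = 0) (P Q : ℤ) (hQ : Q ≠ 0) :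
    1 ≤ |(P : ℝ) - σinf α * Q| * ‖(P : ℚ_[p]) - σp α * Q‖
      * (|(A : ℝ)| * |(P : ℝ) - σinf α * Q| + |2 * A * σinf α + B| * |(Q : ℝ)|) := by
  have hfac : ((A * P ^ 2 + B * P * Q + C * Q ^ 2 : ℤ) : K)
      = (P - α * Q) * (A * P + (A * α + B) * Q) := by
    push_cast
    linear_combination (Q : K) ^ 2 * h
  have hQK : (Q : K) ≠ 0 := by exact_mod_cast hQ
  have hAK : (A : K) ≠ 0 := by exact_mod_cast hA
  -- A zero would make P/Q equal to α or to the other root -B/A - α; either way α would be rational.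
  have hN : A * P ^ 2 + B * P * Q + C * Q ^ 2 ≠ 0 := by
    intro h0
    rw [h0, Int.cast_zero] at hfac
    rcases mul_eq_zero.1 hfac.symm with h1 | h1
    · refine hα ⟨(P : ℚ) / Q, ?_⟩
      simp only [eq_ratCast, Rat.cast_div, Rat.cast_intCast]
      rw [div_eq_iff hQK]
      linear_combination h1
    · refine hα ⟨-(A * P + B * Q : ℚ) / (A * Q), ?_⟩
      simp only [eq_ratCast, Rat.cast_div, Rat.cast_intCast, Rat.cast_neg, Rat.cast_add,
        Rat.cast_mul]
      rw [div_eq_iff (mul_ne_zero hAK hQK)]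
      linear_combination -h1
  have hinf := congrArg σinf hfac
  have hp := congrArg σp hfac
  simp only [map_intCast, map_mul, map_sub, map_add] at hinf hp
  have h1 := one_le_abs_mul_norm_intCast p hN
  rw [hinf, hp, abs_mul, norm_mul] at h1
  have hint : ∀ z : ℤ, ‖(z : ℚ_[p])‖ ≤ 1 := Padic.norm_int_le_one
  have hmul : ∀ x y : ℚ_[p], ‖x‖ ≤ 1 → ‖y‖ ≤ 1 → ‖x * y‖ ≤ 1 := fun x y hx hy => by
    rw [norm_mul]; exact mul_le_one₀ hx (norm_nonneg _) hy
  have hadd : ∀ x y : ℚ_[p], ‖x‖ ≤ 1 → ‖y‖ ≤ 1 → ‖x + y‖ ≤ 1 := fun x y hx hy =>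
    (Padic.nonarchimedean _ _).trans (max_le hx hy)
  have hnorm : ‖(A : ℚ_[p]) * P + (A * σp α + B) * Q‖ ≤ 1 :=
    hadd _ _ (hmul _ _ (hint _) (hint _))
      (hmul _ _ (hadd _ _ (hmul _ _ (hint _) hα1) (hint _)) (hint _))
  -- The second factor is A(P - αQ) + (2Aα + B)Q: close to the derivative of the quadratic at α,
  -- times Q.
  have habs : |(A : ℝ) * P + (A * σinf α + B) * Q|
      ≤ |(A : ℝ)| * |(P : ℝ) - σinf α * Q| + |2 * A * σinf α + B| * |(Q : ℝ)| := by
    rw [← abs_mul, ← abs_mul]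
    refine le_trans (le_of_eq ?_) (abs_add_le _ _)
    congr 1
    ring
  calc (1 : ℝ) ≤ _ := h1
    _ ≤ |(P : ℝ) - σinf α * Q| * (|(A : ℝ)| * |(P : ℝ) - σinf α * Q|
          + |2 * A * σinf α + B| * |(Q : ℝ)|) * (‖(P : ℚ_[p]) - σp α * Q‖ * 1) := by gcongr
    _ = _ := by ring

/-- Descending induction on the threshold: each step replaces c by the minimum of c and one further
positive value. Halving at the end gives strictness. -/
theorem exists_pos_lt_of_eventually_le {f : ℕ → ℝ} {c : ℝ} (hc : 0 < c) (hf : ∀ n, 0 < f n)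
    {N : ℕ} (hN : ∀ n, N ≤ n → c ≤ f n) : ∃ C, 0 < C ∧ ∀ n, C < f n := by
  induction N generalizing c with
  | zero => exact ⟨c / 2, by positivity, fun n => (half_lt_self hc).trans_le (hN n n.zero_le)⟩
  | succ N ih =>
    refine ih (lt_min hc (hf N)) fun n hn => ?_
    rcases hn.eq_or_lt with rfl | h
    · exact min_le_right _ _
    · exact (min_le_left _ _).trans (hN n h)

/-! ### The case p = 2: real sizes and the scaled error -/

section

variable [CharZero K] (σinf : K →+* ℝ) (σ2 : K →+* ℚ_[2]) {α : K}

/-- The parity alternates, so one step is 2 and the other is 1. This is the source of the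
contraction by 1/2 over two consecutive terms. -/
theorem step_two_tau_mul_succ (n : ℕ) :
    (step 2 (tau n) : ℝ) * step 2 (tau (n + 1 : ℕ)) = 2 := by
  rcases Nat.even_or_odd n with h | h
  · have h1 : ¬ Even ((n : ℤ) + 1) := by simpa [Int.even_add_one] using h
    simp [step, tau, h, h1]
  · have h1 : Even ((n : ℤ) + 1) := by simpa [Int.even_add_one] using h
    simp [step, tau, Nat.not_even_iff_odd.2 h, h1]

theorem abs_alphaSeq_mul_succ_lt (hα : α ∉ Set.range (algebraMap ℚ K))
    (hI : PropertyI 2 σinf σ2 α) (n : ℕ) :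
    |σinf (alphaSeq 2 σinf σ2 α (n + 1))| * |σinf (alphaSeq 2 σinf σ2 α (n + 2))| < 1 / 2 := by
  have h1 := abs_alphaSeq_lt 2 σinf σ2 hα hI n
  have h2 := abs_alphaSeq_lt 2 σinf σ2 hα hI (n + 1)
  have h := mul_lt_mul'' h1 h2 (abs_nonneg _) (abs_nonneg _)
  linarith [step_two_tau_mul_succ n]

theorem abs_alphaSeq_le_one (hα : α ∉ Set.range (algebraMap ℚ K))
    (hI : PropertyI 2 σinf σ2 α) (n : ℕ) : |σinf (alphaSeq 2 σinf σ2 α (n + 1))| ≤ 1 := by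
  have h1 := abs_alphaSeq_lt 2 σinf σ2 hα hI n
  have h2 : (step 2 (tau n) : ℝ) ≤ 2 := by unfold step; split_ifs <;> norm_num
  linarith

theorem prod_abs_alphaSeq_pos (hα : α ∉ Set.range (algebraMap ℚ K)) (n : ℕ) :
    0 < ∏ k ∈ Finset.range n, |σinf (alphaSeq 2 σinf σ2 α (k + 1))| :=
  Finset.prod_pos fun k _ => abs_pos.2
    ((map_ne_zero σinf).2 (alphaSeq_ne_zero 2 σinf σ2 hα (k + 1)))

/-- `|q_n| < 2 ∏_{k ≤ n} |α_{(k)}|⁻¹`. -/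
theorem abs_convDen_mul_prod_lt (hα : α ∉ Set.range (algebraMap ℚ K))
    (hI : PropertyI 2 σinf σ2 α) (n : ℕ) :
    |(convDen 2 σinf σ2 α n : ℝ)|
      * ∏ k ∈ Finset.range n, |σinf (alphaSeq 2 σinf σ2 α (k + 1))| < 2 := by
  induction n with
  | zero => simp [convDen, convMatrix]
  | succ n ih =>
    have h := congrArg σinf (convDen_add_alphaSeq_mul 2 σinf σ2 hα (n + 1))
    rw [convMatrix_succ_one_zero] at h
    simp only [map_add, map_mul, map_ratCast, map_prod, map_inv₀] at h
    have hpos := prod_abs_alphaSeq_pos σinf σ2 hα (n + 1)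
    have hD : |∏ k ∈ Finset.range (n + 1), (σinf (alphaSeq 2 σinf σ2 α (k + 1)))⁻¹|
        * ∏ k ∈ Finset.range (n + 1), |σinf (alphaSeq 2 σinf σ2 α (k + 1))| = 1 := by
      rw [Finset.prod_inv_distrib, abs_inv, Finset.abs_prod, inv_mul_cancel₀ hpos.ne']
    have hxy := abs_alphaSeq_mul_succ_lt σinf σ2 hα hI n
    have hle : |(convDen 2 σinf σ2 α (n + 1) : ℝ)|
        ≤ |∏ k ∈ Finset.range (n + 1), (σinf (alphaSeq 2 σinf σ2 α (k + 1)))⁻¹|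
          + |σinf (alphaSeq 2 σinf σ2 α (n + 2))| * |(convDen 2 σinf σ2 α n : ℝ)| := by
      rw [← h, ← abs_mul]
      exact le_trans (le_of_eq (by congr 1; ring)) (abs_sub _ _)
    calc _ ≤ (|∏ k ∈ Finset.range (n + 1), (σinf (alphaSeq 2 σinf σ2 α (k + 1)))⁻¹|
          + |σinf (alphaSeq 2 σinf σ2 α (n + 2))| * |(convDen 2 σinf σ2 α n : ℝ)|)
          * ∏ k ∈ Finset.range (n + 1), |σinf (alphaSeq 2 σinf σ2 α (k + 1))| := by gcongr
      -- The last factor of the product is paired with the coefficient of q_n. The pair is below 1/2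
      -- and the inductive bracket is below 2, so the total stays below 1 + 1.
      _ = 1 + (|σinf (alphaSeq 2 σinf σ2 α (n + 1))| * |σinf (alphaSeq 2 σinf σ2 α (n + 2))|)
          * (|(convDen 2 σinf σ2 α n : ℝ)|
            * ∏ k ∈ Finset.range n, |σinf (alphaSeq 2 σinf σ2 α (k + 1))|) := by
        rw [add_mul, hD, Finset.prod_range_succ]
        ring
      _ < 2 := by
        have h0 : 0 ≤ |(convDen 2 σinf σ2 α n : ℝ)|
            * ∏ k ∈ Finset.range n, |σinf (alphaSeq 2 σinf σ2 α (k + 1))| :=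
          mul_nonneg (abs_nonneg _) (prod_abs_alphaSeq_pos σinf σ2 hα n).le
        have h1 := mul_lt_mul'' hxy ih (by positivity) h0
        linarith

/-- Any geometric decay suffices. Two steps gain 1/2 ≤ (3/4)², and the leading 2 absorbs the first,
unpaired factor, which is only known to be at most 1. -/
theorem prod_abs_alphaSeq_le (hα : α ∉ Set.range (algebraMap ℚ K))
    (hI : PropertyI 2 σinf σ2 α) (n : ℕ) :
    ∏ k ∈ Finset.range n, |σinf (alphaSeq 2 σinf σ2 α (k + 1))| ≤ 2 * (3 / 4) ^ n := by
  induction n using Nat.twoStepInduction with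
  | zero => norm_num
  | one =>
    have := abs_alphaSeq_le_one σinf σ2 hα hI 0
    simp only [Finset.range_one, Finset.prod_singleton]
    linarith
  | more n h0 _ =>
    have h := abs_alphaSeq_mul_succ_lt σinf σ2 hα hI n
    rw [Finset.prod_range_succ, Finset.prod_range_succ, mul_assoc]
    have h1 := mul_le_mul h0 h.le (by positivity) (by positivity)
    refine h1.trans ?_
    rw [pow_add]
    have : (0 : ℝ) < (3 / 4) ^ n := by positivity
    linarith

/-- The approximation error times `q'_n ^ 2`, with denominators cleared. -/
theorem error_mul_sq (hα : α ∉ Set.range (algebraMap ℚ K)) (hI : PropertyI 2 σinf σ2 α)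
    {n : ℕ} (hn : 0 < n) :
    |σinf α - ((convNum' 2 σinf σ2 α n / convDen' 2 σinf σ2 α n : ℚ) : ℝ)|
      * ‖σ2 α - ((convNum' 2 σinf σ2 α n / convDen' 2 σinf σ2 α n : ℚ) : ℚ_[2])‖
      * |(convDen' 2 σinf σ2 α n : ℝ)| ^ 2
    = |(convNum' 2 σinf σ2 α n : ℝ) - σinf α * convDen' 2 σinf σ2 α n|
      * ‖(convNum' 2 σinf σ2 α n : ℚ_[2]) - σ2 α * convDen' 2 σinf σ2 α n‖
      * |(convDen' 2 σinf σ2 α n : ℝ)| := by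
  obtain ⟨P, Q, hP, hQ, hQ0, -⟩ := exists_int_convergent 2 σinf σ2 hα hI n
  have hQ1 := norm_convDen' 2 σinf σ2 hα hI hn
  rw [hQ] at hQ1
  rw [hP, hQ]
  simp only [Rat.cast_intCast, Rat.cast_div] at hQ1 ⊢
  have h1 : (Q : ℝ) ≠ 0 := by exact_mod_cast hQ0
  have h2 : (Q : ℚ_[2]) ≠ 0 := by exact_mod_cast hQ0
  have e1 : (P : ℝ) - σinf α * Q = -((σinf α - P / Q) * Q) := by field_simp; ring
  have e2 : (P : ℚ_[2]) - σ2 α * Q = -((σ2 α - P / Q) * Q) := by field_simp; ring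
  -- As q'_n is a 2-adic unit, clearing the denominator costs one factor |q'_n| at the real place
  -- and nothing at the 2-adic place.
  rw [e1, e2, abs_neg, norm_neg, abs_mul, norm_mul, hQ1]
  ring

theorem error_mul_sq_lt (hα : α ∉ Set.range (algebraMap ℚ K)) (hI : PropertyI 2 σinf σ2 α)
    {n : ℕ} (hn : 0 < n) :
    |σinf α - ((convNum' 2 σinf σ2 α n / convDen' 2 σinf σ2 α n : ℚ) : ℝ)|
      * ‖σ2 α - ((convNum' 2 σinf σ2 α n / convDen' 2 σinf σ2 α n : ℚ) : ℚ_[2])‖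
      * |(convDen' 2 σinf σ2 α n : ℝ)| ^ 2
    < step 2 (tau n) * ‖σ2 (alphaSeq 2 σinf σ2 α (n + 1))‖ := by
  have hS : (0 : ℝ) < convScale 2 σinf σ2 α n := by exact_mod_cast convScale_pos 2 σinf σ2 n
  have hx := abs_alphaSeq_lt 2 σinf σ2 hα hI n
  have hx0 : 0 < |σinf (alphaSeq 2 σinf σ2 α (n + 1))| :=
    abs_pos.2 ((map_ne_zero σinf).2 (alphaSeq_ne_zero 2 σinf σ2 hα (n + 1)))
  have hy0 : 0 < ‖σ2 (alphaSeq 2 σinf σ2 α (n + 1))‖ :=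
    norm_pos_iff.2 ((map_ne_zero σ2).2 (alphaSeq_ne_zero 2 σinf σ2 hα (n + 1)))
  have hq := abs_convDen_mul_prod_lt σinf σ2 hα hI n
  rw [error_mul_sq σinf σ2 hα hI hn, abs_convNum'_sub 2 σinf σ2 hα,
    norm_convNum'_sub 2 σinf σ2 hα hI, Finset.prod_range_succ, convDen']
  push_cast
  rw [abs_mul, abs_of_pos hS]
  calc _ = (|(convDen 2 σinf σ2 α n : ℝ)|
        * ∏ k ∈ Finset.range n, |σinf (alphaSeq 2 σinf σ2 α (k + 1))|)
        * |σinf (alphaSeq 2 σinf σ2 α (n + 1))| * ‖σ2 (alphaSeq 2 σinf σ2 α (n + 1))‖ := by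
        field_simp
    _ < 2 * (step 2 (tau n) / 2) * ‖σ2 (alphaSeq 2 σinf σ2 α (n + 1))‖ := by gcongr
    _ = _ := by ring

theorem error_mul_sq_pos (hα : α ∉ Set.range (algebraMap ℚ K)) (hI : PropertyI 2 σinf σ2 α)
    (n : ℕ) :
    0 < |σinf α - ((convNum' 2 σinf σ2 α n / convDen' 2 σinf σ2 α n : ℚ) : ℝ)|
      * ‖σ2 α - ((convNum' 2 σinf σ2 α n / convDen' 2 σinf σ2 α n : ℚ) : ℚ_[2])‖
      * |(convDen' 2 σinf σ2 α n : ℝ)| ^ 2 := by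
  obtain ⟨P, Q, -, hQ, hQ0, -⟩ := exists_int_convergent 2 σinf σ2 hα hI n
  have hq : (convDen' 2 σinf σ2 α n : ℝ) ≠ 0 := by rw [hQ]; exact_mod_cast hQ0
  generalize convNum' 2 σinf σ2 α n / convDen' 2 σinf σ2 α n = r
  have h1 : σinf α - (r : ℝ) ≠ 0 := fun h =>
    hα ⟨r, σinf.injective (by rw [eq_ratCast, map_ratCast, sub_eq_zero.1 h])⟩
  have h2 : σ2 α - (r : ℚ_[2]) ≠ 0 := fun h =>
    hα ⟨r, σ2.injective (by rw [eq_ratCast, map_ratCast, sub_eq_zero.1 h])⟩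
  positivity

/-- `hsmall` makes the |A| E² F part of the quadratic estimate at most 1/2, so the part |2Aα + B| E
F |Q| carries the other half. The + 1 in the constant makes its denominator positive without showing
2Aα + B ≠ 0. -/
theorem le_error_mul_sq_of_int_quadratic (hα : α ∉ Set.range (algebraMap ℚ K))
    (hI : PropertyI 2 σinf σ2 α) {A B C : ℤ} (hA : A ≠ 0)
    (h : (A : K) * α ^ 2 + B * α + C = 0) {n : ℕ} (hn : 0 < n)
    (hsmall : |(A : ℝ)| * (2 * (3 / 4) ^ (n + 1)) ^ 2 ≤ 1 / 2) :
    1 / (2 * (|2 * A * σinf α + B| + 1)) ≤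
      |σinf α - ((convNum' 2 σinf σ2 α n / convDen' 2 σinf σ2 α n : ℚ) : ℝ)|
      * ‖σ2 α - ((convNum' 2 σinf σ2 α n / convDen' 2 σinf σ2 α n : ℚ) : ℚ_[2])‖
      * |(convDen' 2 σinf σ2 α n : ℝ)| ^ 2 := by
  have hS : (0 : ℝ) < convScale 2 σinf σ2 α n := by exact_mod_cast convScale_pos 2 σinf σ2 n
  have hα1 := norm_lt_one_of_addValuation_pos 2 hI.2
  have hE := abs_convNum'_sub 2 σinf σ2 hα n
  have hF := norm_convNum'_sub 2 σinf σ2 hα hI n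
  have hprod := prod_abs_alphaSeq_le σinf σ2 hα hI (n + 1)
  have hprod0 := prod_abs_alphaSeq_pos σinf σ2 hα (n + 1)
  have hβ := (norm_alphaSeq 2 σinf σ2 hI n).1
  rw [error_mul_sq σinf σ2 hα hI hn]
  -- The scaling factor enters E² as S² and F as S⁻², so it cancels and only the decaying product
  -- remains.
  have hEF : |(convNum' 2 σinf σ2 α n : ℝ) - σinf α * convDen' 2 σinf σ2 α n| ^ 2
      * ‖(convNum' 2 σinf σ2 α n : ℚ_[2]) - σ2 α * convDen' 2 σinf σ2 α n‖
      ≤ (2 * (3 / 4) ^ (n + 1)) ^ 2 := by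
    rw [hE, hF]
    calc _ = (∏ k ∈ Finset.range (n + 1), |σinf (alphaSeq 2 σinf σ2 α (k + 1))|) ^ 2
          * ‖σ2 (alphaSeq 2 σinf σ2 α (n + 1))‖ := by field_simp
      _ ≤ (2 * (3 / 4) ^ (n + 1)) ^ 2 * 1 := by gcongr
      _ = _ := mul_one _
  obtain ⟨P, Q, hP, hQ, hQ0, -⟩ := exists_int_convergent 2 σinf σ2 hα hI n
  have hone := one_le_of_int_quadratic 2 σinf σ2 hα hα1.le hA h P Q hQ0
  rw [hP, hQ] at hEF ⊢
  simp only [Rat.cast_intCast] at hEF ⊢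
  set E := |(P : ℝ) - σinf α * Q|
  set F := ‖(P : ℚ_[2]) - σ2 α * Q‖
  have hEF0 : 0 ≤ E * F * |(Q : ℝ)| := by positivity
  have hA' : |(A : ℝ)| * (E ^ 2 * F) ≤ 1 / 2 :=
    (mul_le_mul_of_nonneg_left hEF (abs_nonneg _)).trans hsmall
  rw [div_le_iff₀ (by positivity)]
  nlinarith

end

end PadicRealCF

/-! ### The main theorem -/

theorem theorem3p24 {K : Type*} [Field K] [NumberField K] (hK : Module.finrank ℚ K = 2)
    (σinf : K →+* ℝ) (σ2 : K →+* ℚ_[2]) (α : K) (hα : α ∉ Set.range (algebraMap ℚ K))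
    (hI : PadicRealCF.PropertyI 2 σinf σ2 α) :
    ∃ C : ℝ, 0 < C ∧ ∀ n : ℕ, 0 < n →
      let p' : ℚ := PadicRealCF.convNum' 2 σinf σ2 α n
      let q' : ℚ := PadicRealCF.convDen' 2 σinf σ2 α n
      let a : ℚ := PadicRealCF.aSeq 2 σinf σ2 α (n + 1)
      let err : ℝ := |σinf α - ((p' / q' : ℚ) : ℝ)| * ‖σ2 α - ((p' / q' : ℚ) : ℚ_[2])‖
      C / |(q' : ℝ)| ^ 2 < err ∧
      err < 2 / ((1 + (PadicRealCF.tau n : ℝ)) * ‖(a : ℚ_[2])‖ * |(q' : ℝ)| ^ 2) ∧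
      err < 1 / |(q' : ℝ)| ^ 2 := by
  obtain ⟨A, B, C, hA, hABC⟩ := PadicRealCF.exists_int_quadratic hK hα
  have hlim : Filter.Tendsto (fun n : ℕ => |(A : ℝ)| * (2 * (3 / 4 : ℝ) ^ (n + 1)) ^ 2)
      Filter.atTop (nhds 0) := by
    have h := (tendsto_pow_atTop_nhds_zero_of_lt_one (r := (3 / 4 : ℝ)) (by norm_num)
      (by norm_num)).comp (Filter.tendsto_add_atTop_nat 1)
    simpa using ((h.const_mul 2).pow 2).const_mul |(A : ℝ)|
  obtain ⟨N, hN⟩ := Filter.eventually_atTop.1 (hlim.eventually_le_const (u := 1 / 2) (by norm_num))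
  -- The threshold N + 1 keeps n positive, as the lower bound requires; the positivity of the scaled
  -- error covers every smaller n, including 0.
  obtain ⟨c, hc, hlow⟩ := PadicRealCF.exists_pos_lt_of_eventually_le (N := N + 1)
    (c := 1 / (2 * (|2 * A * σinf α + B| + 1))) (by positivity)
    (PadicRealCF.error_mul_sq_pos σinf σ2 hα hI) fun n hn =>
      PadicRealCF.le_error_mul_sq_of_int_quadratic σinf σ2 hα hI hA hABC (by omega)
        (hN n (by omega))
  refine ⟨c, hc, fun n hn => ?_⟩
  intro p' q' a err
  obtain ⟨P, Q, -, hQ, hQ0, -⟩ := PadicRealCF.exists_int_convergent 2 σinf σ2 hα hI n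
  have hq : (0 : ℝ) < |(q' : ℝ)| ^ 2 := by
    have : (q' : ℝ) ≠ 0 := by
      simp only [q', hQ]
      exact_mod_cast hQ0
    positivity
  have hup : err * |(q' : ℝ)| ^ 2 < _ := PadicRealCF.error_mul_sq_lt σinf σ2 hα hI hn
  have ha : ‖(a : ℚ_[2])‖ = ‖σ2 (PadicRealCF.alphaSeq 2 σinf σ2 α (n + 1))‖⁻¹ :=
    PadicRealCF.norm_aSeq_eq 2 σinf σ2 hα hI n
  have ha1 : 1 ≤ ‖(a : ℚ_[2])‖ := (PadicRealCF.norm_aSeq 2 σinf σ2 hα hI n).1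
  have ha0 : 0 < ‖(a : ℚ_[2])‖ := by linarith
  -- This turns |α_{n+1}|_2 into |a_{n+1}|_2⁻¹, so that the scaled error is bounded by
  -- s/|a_{n+1}|_2, the common source of both upper bounds.
  rw [← inv_inv ‖σ2 (PadicRealCF.alphaSeq 2 σinf σ2 α (n + 1))‖, ← ha] at hup
  have hstep : (PadicRealCF.step 2 (PadicRealCF.tau n) : ℝ)
      = 2 / (1 + (PadicRealCF.tau n : ℝ)) := by
    unfold PadicRealCF.step PadicRealCF.tau
    split_ifs <;> norm_num at *
  refine ⟨(div_lt_iff₀ hq).2 (hlow n), ?_, ?_⟩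
  · rw [← div_div, lt_div_iff₀ hq, ← div_div, ← hstep]
    exact hup
  · rw [lt_div_iff₀ hq]
    refine hup.trans_le ?_
    rw [← div_eq_mul_inv, div_le_one ha0]
    exact PadicRealCF.step_le_norm_aSeq 2 σinf σ2 hα hI n
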